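/- Let $\mathcal K$ be a category. An object $M$ of $\mathcal K$ is finitely presentable if $\mathrm{Hom}(M,-)$ preserves directed colimits. The category $\mathcal K$ is locally finitely presentable if it is cocomplete and has a set $\mathcal A$ of finitely presentable objects such that every object of $\mathcal K$ is a directed colimit of objects from $\mathcal A$. A morphism $h\colon K\to L$ is pure if, for all morphisms $f\colon M\to N$, $u\colon M\to K$, $v\colon N\to L$ with $M$ and $N$ finitely presentable and $hu=vf$, there is a morphism $g\colon N\to K$ with $gf=u$; a pure monomorphism is a monomorphism that is pure. (In a locally finitely presentable category every pure morphism is a monomorphism.) A class of morphisms is cofibrantly closed if it is closed under pushouts along arbitrary morphisms, under transfinite compositions (of smooth chains of arbitrary ordinal length, including length $0$), and under retracts in the category of morphisms of $\mathcal K$. Theorem. In every locally finitely presentable additive category $\mathcal K$, the class of pure monomorphisms is cofibrantly generated: there is a set $\mathcal X$ of morphisms of $\mathcal K$ such that the class of pure monomorphisms is exactly the closure of $\mathcal X$ under pushouts, transfinite compositions and retracts, that is, the smallest cofibrantly closed class of morphisms containing $\mathcal X$. In particular, this holds for the category of all (left) modules over any ring $R$. -/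

import Mathlib

open CategoryTheory Limits

universe w v u

/-- A morphism `h : K ⟶ L` is pure if for every commutative square `u ≫ h = f ≫ v` with
`f : M ⟶ N` a morphism between finitely presentable objects, `u` factors through `f`. -/
def CategoryTheory.IsPure {C : Type u} [Category.{v} C] {K L : C} (h : K ⟶ L) : Prop :=
  ∀ ⦃M N : C⦄, IsFinitelyPresentable.{w} M → IsFinitelyPresentable.{w} N →
    ∀ (f : M ⟶ N) (u : M ⟶ K) (v : N ⟶ L), u ≫ h = f ≫ v → ∃ g : N ⟶ K, f ≫ g = u

namespace CategoryTheory.MorphismProperty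

/-- The class of pure monomorphisms of `C`. -/
def pureMonomorphisms (C : Type u) [Category.{v} C] : MorphismProperty C :=
  fun _ _ h => IsPure.{w} h ∧ Mono h

/-- A class of morphisms is cofibrantly closed if it is closed under pushouts,
transfinite compositions (of arbitrary `w`-small well-ordered shape, including the
empty composition) and retracts in the category of morphisms. -/
structure IsCofibrantlyClosed {C : Type u} [Category.{v} C] (W : MorphismProperty C) : Prop where
  pushout : W.IsStableUnderCobaseChange
  transfiniteComposition : IsStableUnderTransfiniteComposition.{w} W
  retract : W.IsStableUnderRetracts

/-- The closure of a class of morphisms under pushouts, transfinite compositions and retracts: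
the smallest cofibrantly closed class containing it. -/
def cofibrantClosure {C : Type u} [Category.{v} C] (X : MorphismProperty C) :
    MorphismProperty C :=
  fun _ _ f => ∀ W : MorphismProperty C, IsCofibrantlyClosed.{w} W → X ≤ W → W f

/-- A class of morphisms is cofibrantly generated if it is the closure of a (small) set of
morphisms under pushouts, transfinite compositions and retracts. -/
def IsCofibrantlyGenerated {C : Type u} [Category.{v} C] (W : MorphismProperty C) : Prop :=
  ∃ X : MorphismProperty C, IsSmall.{w} X ∧ cofibrantClosure.{w} X = W

end CategoryTheory.MorphismProperty

/-!
Fix a small family `G` of representatives of the finitely presentable objects. A morphism is a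
pure monomorphism if and only if it is the first map of a sequence `K ⟶ L ⟶ S` inducing short
exact sequences `0 ⟶ Hom(G a, K) ⟶ Hom(G a, L) ⟶ Hom(G a, S) ⟶ 0`. Every pure subfunctor of
`Hom(-, L)`, as well as the quotient by it, is a filtered colimit of representable functors, so it
is represented by an object of the category.

Let `κ` be an uncountable regular cardinal larger than the number of morphisms between the objects
`G a`. A proper pure subfunctor of `Hom(-, L)` is contained in a strictly larger one such that the
quotient is represented by a `κ`-presentable object. Therefore every pure monomorphism is a
transfinite composition of pure monomorphisms with a `κ`-presentable quotient `S`. Each of the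
latter is a pushout of a kernel of `P ⟶ S`, where `P` is the coproduct of the sources of all
morphisms `G a ⟶ S`, and there is only a set of such `S` up to isomorphism.
-/

namespace CategoryTheory.IsPure

variable {C : Type u} [Category.{v} C] {K L L' : C} {h : K ⟶ L}

lemma comp {h' : L ⟶ L'} (hh : IsPure.{w} h) (hh' : IsPure.{w} h') : IsPure.{w} (h ≫ h') := by
  intro M N hM hN f u v e
  obtain ⟨g, hg⟩ := hh' hM hN f (u ≫ h) v (by simpa using e)
  exact hh hM hN f u g hg.symm

lemma of_comp {h' : L ⟶ L'} (hh : IsPure.{w} (h ≫ h')) : IsPure.{w} h := by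
  intro M N hM hN f u v e
  exact hh hM hN f u (v ≫ h') (by simp [reassoc_of% e])

lemma of_isIso [IsIso h] : IsPure.{w} h := fun _ _ _ _ f u v e ↦
  ⟨v ≫ inv h, by rw [← Category.assoc, ← e, Category.assoc, IsIso.hom_inv_id, Category.comp_id]⟩

lemma of_isSplitMono [IsSplitMono h] : IsPure.{w} h :=
  of_comp (h' := retraction h) (by rw [IsSplitMono.id]; exact of_isIso)

lemma of_retractArrow {K' L' : C} {h' : K' ⟶ L'} (r : RetractArrow h h') (hh : IsPure.{w} h') :
    IsPure.{w} h := by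
  have hr : r.i.left ≫ h' = h ≫ r.i.right := r.i_w
  have : IsSplitMono r.i.left := ⟨⟨⟨r.r.left, r.retract_left⟩⟩⟩
  exact of_comp (hr ▸ of_isSplitMono.comp hh)

lemma of_isColimit {J : Type w} [SmallCategory J] [IsFiltered J] {F F' : J ⥤ C}
    {c : Cocone F} {c' : Cocone F'} (hc : IsColimit c) (hc' : IsColimit c') (f : F ⟶ F')
    (hf : ∀ j, IsPure.{w} (f.app j)) (φ : c.pt ⟶ c'.pt)
    (hφ : ∀ j, c.ι.app j ≫ φ = f.app j ≫ c'.ι.app j) : IsPure.{w} φ := by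
  intro M N hM hN p u v e
  obtain ⟨i, u, rfl⟩ := IsFinitelyPresentable.exists_hom_of_isColimit hc u
  obtain ⟨j, v, rfl⟩ := IsFinitelyPresentable.exists_hom_of_isColimit hc' v
  obtain ⟨k, s, t, hst⟩ := IsFinitelyPresentable.exists_eq_of_isColimit hc'
    (u ≫ f.app i) (p ≫ v) (by simpa [hφ] using e)
  obtain ⟨g, hg⟩ := hf k hM hN p (u ≫ F.map s) (v ≫ F'.map t) (by simpa using hst)
  exact ⟨g ≫ c.ι.app k, by simp [reassoc_of% hg]⟩

end CategoryTheory.IsPure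

namespace Purity

attribute [local instance] Cardinal.fact_isRegular_aleph0

lemma isFinitelyPresentable_of_isZero {C : Type u} [Category.{w} C] {Z : C}
    (hZ : IsZero Z) : IsFinitelyPresentable.{w} Z :=
  have (k : Discrete PEmpty.{1}) :
      IsCardinalPresentable ((Functor.empty.{0} C).obj k) Cardinal.aleph0.{w} := k.as.elim
  isCardinalPresentable_of_isColimit.{w} (asEmptyCocone Z) hZ.isInitial Cardinal.aleph0.{w}
    (by rw [hasCardinalLT_aleph0_iff]; infer_instance)

/-- A family of finitely presentable objects which meets every isomorphism class of finitely
presentable objects. It replaces the category of finitely presentable objects by the equivalent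
category `InducedCategory C G`, which is small. -/
structure IsFPFamily {C : Type u} [Category.{w} C] {A : Type w} (G : A → C) : Prop where
  isFinitelyPresentable (a : A) : IsFinitelyPresentable.{w} (G a)
  exists_iso (M : C) [IsFinitelyPresentable.{w} M] : ∃ a, Nonempty (M ≅ G a)

variable {C : Type u} [Category.{w} C]

lemma exists_isFPFamily [IsLocallyFinitelyPresentable.{w} C] :
    ∃ (A : Type w) (G : A → C), IsFPFamily G := by
  obtain ⟨Q, _, hQ, hQ'⟩ := ObjectProperty.EssentiallySmall.exists_small_le.{w}
    (ObjectProperty.isFinitelyPresentable.{w} C)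
  refine ⟨Shrink.{w} (Subtype Q), fun a ↦ ((equivShrink _).symm a).1, fun a ↦ ?_, fun M hM ↦ ?_⟩
  · exact hQ _ ((equivShrink _).symm a).2
  · obtain ⟨N, hN, ⟨e⟩⟩ := hQ' M hM
    exact ⟨equivShrink _ ⟨N, hN⟩, ⟨e ≪≫ eqToIso (by simp)⟩⟩

namespace IsFPFamily

variable {A : Type w} {G : A → C}

lemma nonempty [HasZeroObject C] (hG : IsFPFamily G) : Nonempty A := by
  obtain ⟨Z, hZ⟩ := HasZeroObject.zero (C := C)
  have := isFinitelyPresentable_of_isZero hZ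
  obtain ⟨a, -⟩ := hG.exists_iso Z
  exact ⟨a⟩

lemma exists_iso_of_isColimit (hG : IsFPFamily G) {J : Type} [SmallCategory J] [FinCategory J]
    (F : J ⥤ C) (hF : ∀ j, F.obj j ∈ Set.range G) {c : Cocone F} (hc : IsColimit c) :
    ∃ b, Nonempty (c.pt ≅ G b) := by
  have (j : J) : IsFinitelyPresentable.{w} (F.obj j) := by
    obtain ⟨a, ha⟩ := hF j
    rw [← ha]
    exact hG.isFinitelyPresentable a
  have : IsFinitelyPresentable.{w} c.pt :=
    isCardinalPresentable_of_isColimit.{w} c hc Cardinal.aleph0.{w}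
      (by rw [hasCardinalLT_aleph0_iff]; infer_instance)
  exact hG.exists_iso _

lemma isPure_of_exists_lift (hG : IsFPFamily G) {K L : C} {h : K ⟶ L}
    (H : ∀ ⦃a b⦄ (f : G a ⟶ G b) (u : G a ⟶ K) (v : G b ⟶ L), u ≫ h = f ≫ v → ∃ g, f ≫ g = u) :
    IsPure.{w} h := by
  intro M N hM hN f u v e
  obtain ⟨a, ⟨i⟩⟩ := hG.exists_iso M
  obtain ⟨b, ⟨j⟩⟩ := hG.exists_iso N
  obtain ⟨g, hg⟩ := H (i.inv ≫ f ≫ j.hom) (i.inv ≫ u) (j.inv ≫ v) (by simp [e])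
  exact ⟨j.hom ≫ g, by simpa using hg⟩

lemma exists_weakCokernel [IsLocallyFinitelyPresentable.{w} C] [Preadditive C]
    (hG : IsFPFamily G) {a b : A} (f : G a ⟶ G b) :
    ∃ (c : A) (e : G b ⟶ G c), f ≫ e = 0 ∧
      ∀ ⦃X : C⦄ (y : G b ⟶ X), f ≫ y = 0 → ∃ y' : G c ⟶ X, e ≫ y' = y := by
  have : HasFiniteColimits C := hasFiniteColimits_of_hasColimitsOfSize C
  obtain ⟨c, ⟨i⟩⟩ := hG.exists_iso_of_isColimit (parallelPair f 0)
    (by rintro (_ | _); exacts [⟨_, rfl⟩, ⟨_, rfl⟩]) (cokernelIsCokernel f)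
  replace i : cokernel f ≅ G c := i
  exact ⟨c, cokernel.π f ≫ i.hom, by simp, fun X y hy ↦ ⟨i.inv ≫ cokernel.desc f y hy, by simp⟩⟩

lemma hasBinaryBiproducts [Preadditive C] [HasBinaryBiproducts C] (hG : IsFPFamily G) :
    HasBinaryBiproducts (InducedCategory C G) where
  has_binary_biproduct a b := by
    obtain ⟨c, ⟨i⟩⟩ := hG.exists_iso_of_isColimit (pair (G a) (G b))
      (by rintro ⟨_ | _⟩; exacts [⟨_, rfl⟩, ⟨_, rfl⟩])
      (BinaryBiproduct.isColimit (G a) (G b))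
    replace i : G a ⊞ G b ≅ G c := i
    exact hasBinaryBiproduct_of_total
      { pt := (c : InducedCategory C G)
        fst := InducedCategory.homMk (i.inv ≫ biprod.fst)
        snd := InducedCategory.homMk (i.inv ≫ biprod.snd)
        inl := InducedCategory.homMk (biprod.inl ≫ i.hom)
        inr := InducedCategory.homMk (biprod.inr ≫ i.hom)
        inl_fst := by ext; simp
        inl_snd := InducedCategory.hom_ext
          (show (biprod.inl ≫ i.hom) ≫ i.inv ≫ biprod.snd = 0 by simp)
        inr_fst := InducedCategory.hom_ext
          (show (biprod.inr ≫ i.hom) ≫ i.inv ≫ biprod.fst = 0 by simp)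
        inr_snd := by ext; simp }
      (InducedCategory.hom_ext (show (i.inv ≫ biprod.fst) ≫ biprod.inl ≫ i.hom +
        (i.inv ≫ biprod.snd) ≫ biprod.inr ≫ i.hom = 𝟙 (G c) by
          simp only [Category.assoc, ← Preadditive.comp_add]
          simp only [← Category.assoc, ← Preadditive.add_comp]
          simp))

section

variable [IsLocallyFinitelyPresentable.{w} C] (hG : IsFPFamily G)

include hG

lemma isDense : (inducedFunctor G).IsDense := by
  let P := ObjectProperty.isFinitelyPresentable.{w} C
  let E : InducedCategory C G ⥤ P.FullSubcategory :=
    P.lift (inducedFunctor G) hG.isFinitelyPresentable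
  have : E.EssSurj := ⟨fun M ↦ by
    have : IsFinitelyPresentable.{w} M.1 := M.2
    obtain ⟨a, ⟨e⟩⟩ := hG.exists_iso M.1
    exact ⟨a, ⟨P.isoMk e.symm⟩⟩⟩
  have : E.Full := .of_comp_faithful_iso (P.liftCompιIso (inducedFunctor G) _)
  have : E.Faithful := .of_comp_iso (P.liftCompιIso (inducedFunctor G) _)
  have : E.IsEquivalence := { }
  exact inferInstanceAs (E ⋙ P.ι).IsDense

lemma hom_ext {X Y : C} {f g : X ⟶ Y} (h : ∀ a (x : G a ⟶ X), x ≫ f = x ≫ g) : f = g := by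
  have := hG.isDense
  refine ((inducedFunctor G).denseAt X).hom_ext fun p ↦ ?_
  change (𝟙 (G p.left) ≫ p.hom) ≫ f = (𝟙 (G p.left) ≫ p.hom) ≫ g
  rw [Category.id_comp, h]

lemma exists_hom {X Y : C} (φ : ∀ a, (G a ⟶ X) → (G a ⟶ Y))
    (hφ : ∀ a b (f : G a ⟶ G b) (x : G b ⟶ X), φ a (f ≫ x) = f ≫ φ b x) :
    ∃ f : X ⟶ Y, ∀ a x, x ≫ f = φ a x := by
  have := hG.isDense
  let D := (inducedFunctor G).denseAt X
  let c : Cocone (CostructuredArrow.proj (inducedFunctor G) X ⋙ inducedFunctor G) :=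
    { pt := Y
      ι :=
        { app p := φ p.left p.hom
          naturality p q t := by
            have ht : t.left.hom ≫ q.hom = p.hom := CostructuredArrow.w t
            exact (hφ _ _ t.left.hom q.hom).symm.trans
              (by rw [ht]; exact (Category.comp_id _).symm) } }
  refine ⟨D.desc c, fun a x ↦ ?_⟩
  have := D.fac c (.mk (Y := (show InducedCategory C G from a)) x)
  change (𝟙 (G a) ≫ x) ≫ D.desc c = φ a x at this
  rwa [Category.id_comp] at this

lemma exists_lift {X Y L : C} (g : X ⟶ L) (j : Y ⟶ L) [Mono j]
    (h : ∀ a (x : G a ⟶ X), ∃ y, y ≫ j = x ≫ g) : ∃ k : X ⟶ Y, k ≫ j = g := by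
  choose φ hφ using h
  obtain ⟨k, hk⟩ := hG.exists_hom φ (fun a b f x ↦ by simp [← cancel_mono j, hφ])
  exact ⟨k, hG.hom_ext fun a x ↦ by rw [← Category.assoc, hk, hφ]⟩

lemma mono_of_injective {X Y : C} (f : X ⟶ Y)
    (h : ∀ a, Function.Injective fun x : G a ⟶ X ↦ x ≫ f) : Mono f where
  right_cancellation g g' e := hG.hom_ext fun a x ↦ h a (by simp [e])

end

end IsFPFamily

lemma hasCardinalLT_arrow_costructuredArrow {D : Type w} [SmallCategory D] (F : D ⥤ C) {X : C}
    {κ : Cardinal.{w}} [Fact κ.IsRegular] (hD : HasCardinalLT (Arrow D) κ)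
    (hX : ∀ d, HasCardinalLT (F.obj d ⟶ X) κ) :
    HasCardinalLT (Arrow (CostructuredArrow F X)) κ := by
  let f (t : Σ t : Arrow D, F.obj t.right ⟶ X) : Arrow (CostructuredArrow F X) :=
    Arrow.mk (CostructuredArrow.mkPrecomp t.2 t.1.hom)
  refine (hasCardinalLT_sigma _ κ hD fun t ↦ hX t.right).of_surjective f fun ⟨p, q, t⟩ ↦ ?_
  obtain ⟨a, x, rfl⟩ := CostructuredArrow.mk_surjective p
  obtain ⟨b, y, rfl⟩ := CostructuredArrow.mk_surjective q
  obtain ⟨t, w, rfl⟩ := CostructuredArrow.homMk_surjective (f := .mk x) (f' := .mk y) t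
  change a ⟶ b at t
  change F.map t ≫ y = x at w
  subst w
  exact ⟨⟨Arrow.mk t, y⟩, rfl⟩

lemma isCardinalPresentable_of_isDense {D : Type w} [SmallCategory D] (F : D ⥤ C) [F.IsDense]
    (κ : Cardinal.{w}) [Fact κ.IsRegular] [∀ d, IsCardinalPresentable (F.obj d) κ]
    (hD : HasCardinalLT (Arrow D) κ) {X : C} (hX : ∀ d, HasCardinalLT (F.obj d ⟶ X) κ) :
    IsCardinalPresentable X κ :=
  have (p : CostructuredArrow F X) :
      IsCardinalPresentable ((CostructuredArrow.proj F X ⋙ F).obj p) κ :=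
    inferInstanceAs (IsCardinalPresentable (F.obj p.left) κ)
  isCardinalPresentable_of_isColimit.{w} _ (F.denseAt X) κ
    (hasCardinalLT_arrow_costructuredArrow F hD hX)

lemma exists_iso_of_isFiltered_elements [HasFilteredColimitsOfSize.{w, w} C] {D : Type w}
    [SmallCategory D] (F : D ⥤ C) [F.Full] [F.Faithful]
    [∀ d, IsFinitelyPresentable.{w} (F.obj d)] (Q : Dᵒᵖ ⥤ Type w) [IsFiltered Q.Elementsᵒᵖ] :
    ∃ X : C, Nonempty (Q ≅ F.op ⋙ yoneda.obj X) := by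
  let E : Q.Elementsᵒᵖ ⥤ C := (CategoryOfElements.π Q).leftOp ⋙ F
  let ι (d : Dᵒᵖ) (q : Q.obj d) : F.obj d.unop ⟶ colimit E := colimit.ι E (.op ⟨d, q⟩)
  have hι {d d' : Dᵒᵖ} (f : d' ⟶ d) (q : Q.obj d') :
      ι d (Q.map f q) = F.map f.unop ≫ ι d' q :=
    (colimit.w E
      (CategoryOfElements.homMk (F := Q ⋙ forget _) ⟨d', q⟩ ⟨d, Q.map f q⟩ f rfl).op).symm
  have ι_injective (d : Dᵒᵖ) : Function.Injective (ι d) := fun q r h ↦ by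
    obtain ⟨k, s, t, hst⟩ := IsFinitelyPresentable.exists_eq_of_isColimit
      (colimit.isColimit E) (X := F.obj d.unop) (i := .op ⟨d, q⟩) (j := .op ⟨d, r⟩) (𝟙 _) (𝟙 _)
      (congr_arg (𝟙 (F.obj d.unop) ≫ ·) h)
    have hst : s.unop.val = t.unop.val :=
      Quiver.Hom.unop_inj (F.map_injective ((Category.id_comp _).symm.trans
        (hst.trans (Category.id_comp _))))
    exact s.unop.property.symm.trans ((congr_arg (Q.map · _) hst).trans t.unop.property)
  have ι_surjective (d : Dᵒᵖ) : Function.Surjective (ι d) := fun x ↦ by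
    obtain ⟨⟨d', q⟩, p, rfl⟩ := IsFinitelyPresentable.exists_hom_of_isColimit
      (colimit.isColimit E) x
    obtain ⟨f, rfl⟩ := F.map_surjective p
    exact ⟨Q.map f.op q, hι f.op q⟩
  exact ⟨colimit E, ⟨NatIso.ofComponents
    (fun d ↦ (Equiv.ofBijective (ι d) ⟨ι_injective d, ι_surjective d⟩).toIso)
    fun f ↦ by ext q; exact hι f q⟩⟩

lemma IsFPFamily.isCardinalPresentable [IsLocallyFinitelyPresentable.{w} C] {A : Type w}
    {G : A → C} (hG : IsFPFamily G) (κ : Cardinal.{w}) [Fact κ.IsRegular]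
    (hκ : HasCardinalLT (Arrow (InducedCategory C G)) κ) {X : C}
    (hX : ∀ a, HasCardinalLT (G a ⟶ X) κ) : IsCardinalPresentable X κ := by
  have := hG.isDense
  have (a : InducedCategory C G) : IsCardinalPresentable ((inducedFunctor G).obj a) κ :=
    have := hG.isFinitelyPresentable a
    isCardinalPresentable_of_le (κ := Cardinal.aleph0.{w}) (G a)
      (Cardinal.IsRegular.aleph0_le Fact.out)
  exact isCardinalPresentable_of_isDense (inducedFunctor G) κ hκ hX

open Opposite in
lemma isFiltered_elements {D : Type w} [SmallCategory D] [Preadditive D] [Nonempty D]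
    [HasBinaryBiproducts D] (Q : Dᵒᵖ ⥤ AddCommGrpCat.{w}) [Q.Additive]
    (hQ : ∀ ⦃a b : D⦄ (f : a ⟶ b) (q : Q.obj (op b)), Q.map f.op q = 0 →
      ∃ (c : D) (e : b ⟶ c) (s : Q.obj (op c)), f ≫ e = 0 ∧ Q.map e.op s = q) :
    IsFiltered (Q ⋙ forget AddCommGrpCat).Elementsᵒᵖ where
  nonempty := ⟨op ⟨op (Classical.arbitrary D), (0 : Q.obj (op _))⟩⟩
  cocone_objs := by
    rintro ⟨⟨a⟩, q⟩ ⟨⟨b⟩, r⟩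
    change Q.obj (op a) at q
    change Q.obj (op b) at r
    let s : Q.obj (op (a ⊞ b)) := Q.map biprod.fst.op q + Q.map biprod.snd.op r
    have hq : Q.map biprod.inl.op s = q := by
      simp only [s, map_add, ← ConcreteCategory.comp_apply, ← Q.map_comp, ← op_comp]
      simp
    have hr : Q.map biprod.inr.op s = r := by
      simp only [s, map_add, ← ConcreteCategory.comp_apply, ← Q.map_comp, ← op_comp]
      simp
    exact ⟨op ⟨op (a ⊞ b), s⟩,
      (CategoryOfElements.homMk (F := Q ⋙ forget _) ⟨op (a ⊞ b), s⟩ ⟨op a, q⟩ biprod.inl.op hq).op,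
      (CategoryOfElements.homMk (F := Q ⋙ forget _) ⟨op (a ⊞ b), s⟩ ⟨op b, r⟩ biprod.inr.op hr).op,
      trivial⟩
  cocone_maps := by
    rintro ⟨⟨a⟩, q⟩ ⟨⟨b⟩, r⟩ f g
    change Q.obj (op b) at r
    have hf : Q.map f.unop.val r = q := f.unop.property
    have hg : Q.map g.unop.val r = q := g.unop.property
    obtain ⟨c, e, s, he, hs⟩ := hQ (f.unop.val.unop - g.unop.val.unop) r (by
      simp [Functor.map_sub, hf, hg])
    refine ⟨op ⟨op c, s⟩,
      (CategoryOfElements.homMk (F := Q ⋙ forget _) ⟨op c, s⟩ ⟨op b, r⟩ e.op hs).op,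
      Quiver.Hom.unop_inj (CategoryOfElements.ext _ _ _ (Quiver.Hom.unop_inj ?_))⟩
    rw [Preadditive.sub_comp, sub_eq_zero] at he
    exact he

variable [Preadditive C] {A : Type w} {G : A → C}

open Opposite in
lemma IsFPFamily.exists_representation [HasFiniteBiproducts C] [IsLocallyFinitelyPresentable.{w} C]
    (hG : IsFPFamily G)
    (Q : (InducedCategory C G)ᵒᵖ ⥤ AddCommGrpCat.{w}) [Q.Additive]
    (hQ : ∀ ⦃a b : InducedCategory C G⦄ (f : a ⟶ b) (q : Q.obj (op b)), Q.map f.op q = 0 →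
      ∃ (c : InducedCategory C G) (e : b ⟶ c) (s : Q.obj (op c)), f ≫ e = 0 ∧ Q.map e.op s = q) :
    ∃ (X : C) (e : ∀ a : InducedCategory C G, Q.obj (op a) ≃ (G a ⟶ X)),
      ∀ ⦃a b : InducedCategory C G⦄ (f : a ⟶ b) (q : Q.obj (op b)),
        e a (Q.map f.op q) = f.hom ≫ e b q := by
  have := hasZeroObject_of_hasFiniteBiproducts C
  have := hasBinaryBiproducts_of_finite_biproducts C
  have : Nonempty (InducedCategory C G) := hG.nonempty
  have := hG.hasBinaryBiproducts
  have := isFiltered_elements Q hQ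
  have (a : InducedCategory C G) : IsFinitelyPresentable.{w} ((inducedFunctor G).obj a) :=
    hG.isFinitelyPresentable a
  obtain ⟨X, ⟨e⟩⟩ := exists_iso_of_isFiltered_elements (inducedFunctor G) (Q ⋙ forget _)
  exact ⟨X, fun a ↦ (e.app (op a)).toEquiv,
    fun a b f q ↦ ConcreteCategory.congr_hom (e.hom.naturality f.op) q⟩

/-! ### Pure subfunctors and pure exact sequences -/

/-- A family of subgroups of the groups `G a ⟶ L` is a pure subfunctor of `Hom(-, L)`, restricted
to the objects `G a`, if it is stable under precomposition and if an equation `f ≫ x = y` with `y`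
in the subfunctor has a solution in the subfunctor as soon as it has a solution. -/
structure IsPureSubfunctor {L : C} (T : ∀ a, AddSubgroup (G a ⟶ L)) : Prop where
  comp_mem ⦃a b : A⦄ (f : G a ⟶ G b) {x : G b ⟶ L} : x ∈ T b → f ≫ x ∈ T a
  exists_eq ⦃a b : A⦄ (f : G a ⟶ G b) (x : G b ⟶ L) : f ≫ x ∈ T a → ∃ y ∈ T b, f ≫ y = f ≫ x

variable (G) in
/-- The subfunctor of `Hom(-, L)` consisting of the morphisms from the objects `G a` which factor
through `h`. -/
def homImage {K L : C} (h : K ⟶ L) (a : A) : AddSubgroup (G a ⟶ L) :=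
  (Preadditive.rightComp (G a) h).range

variable {K L S : C} {h : K ⟶ L} {c : L ⟶ S}

@[simp]
lemma mem_homImage {a : A} {x : G a ⟶ L} : x ∈ homImage G h a ↔ ∃ y, y ≫ h = x := Iff.rfl

namespace IsPureSubfunctor

lemma of_isPure (hG : IsFPFamily G) (hh : IsPure.{w} h) : IsPureSubfunctor (homImage G h) where
  comp_mem := by
    rintro a b f _ ⟨x, rfl⟩
    exact ⟨f ≫ x, Category.assoc f x h⟩
  exists_eq := by
    rintro a b f x ⟨u, hu : u ≫ h = f ≫ x⟩
    obtain ⟨g, rfl⟩ := hh (hG.isFinitelyPresentable a) (hG.isFinitelyPresentable b) f u x hu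
    exact ⟨g ≫ h, ⟨g, rfl⟩, by simpa using hu⟩

lemma isPure (hG : IsFPFamily G) [Mono h] (hh : IsPureSubfunctor (homImage G h)) :
    IsPure.{w} h := hG.isPure_of_exists_lift fun a b f u v e ↦ by
  obtain ⟨_, ⟨g, rfl⟩, hg⟩ := hh.exists_eq f v (mem_homImage.2 ⟨u, e⟩)
  refine ⟨g, ?_⟩
  rw [← cancel_mono h, e]
  exact (Category.assoc f g h).trans hg

variable {T : ∀ a, AddSubgroup (G a ⟶ L)}

/-- A pure subfunctor as a presheaf of abelian groups. -/
def presheaf (hT : IsPureSubfunctor T) : (InducedCategory C G)ᵒᵖ ⥤ AddCommGrpCat.{w} where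
  obj a := .of (T a.unop)
  map f := AddCommGrpCat.ofHom <|
    ((Preadditive.leftComp L f.unop.hom).comp (T _).subtype).codRestrict (T _)
      fun x ↦ hT.comp_mem f.unop.hom x.2
  map_id a := by ext x; exact Category.id_comp x.1
  map_comp f g := by ext x; exact Category.assoc g.unop.hom f.unop.hom x.1

instance (hT : IsPureSubfunctor T) : hT.presheaf.Additive where
  map_add {_ _ f g} := by
    ext x
    exact Subtype.ext (Preadditive.add_comp _ _ _ f.unop.hom g.unop.hom x.1)

/-- The quotient of `Hom(-, L)` by a pure subfunctor. -/
def quotient (hT : IsPureSubfunctor T) : (InducedCategory C G)ᵒᵖ ⥤ AddCommGrpCat.{w} where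
  obj a := .of ((G a.unop ⟶ L) ⧸ T a.unop)
  map f := AddCommGrpCat.ofHom (QuotientAddGroup.map (T _) (T _)
    (Preadditive.leftComp L f.unop.hom) fun _ hx ↦ hT.comp_mem f.unop.hom hx)
  map_id a := by ext x; exact congr_arg QuotientAddGroup.mk (Category.id_comp x)
  map_comp f g := by
    ext x
    exact congr_arg QuotientAddGroup.mk (Category.assoc g.unop.hom f.unop.hom x)

instance (hT : IsPureSubfunctor T) : hT.quotient.Additive where
  map_add {_ _ f g} := by
    ext ⟨x⟩
    exact congr_arg QuotientAddGroup.mk (Preadditive.add_comp _ _ _ f.unop.hom g.unop.hom x)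

variable [HasFiniteBiproducts C] [IsLocallyFinitelyPresentable.{w} C]

lemma exists_mono (hG : IsFPFamily G) (hT : IsPureSubfunctor T) :
    ∃ (X : C) (j : X ⟶ L), Mono j ∧ homImage G j = T := by
  obtain ⟨X, e, he⟩ := hG.exists_representation hT.presheaf fun a b f q hq ↦ by
    obtain ⟨c, e, he, hc⟩ := hG.exists_weakCokernel f.hom
    obtain ⟨y, hy⟩ := hc q.1 (congr_arg Subtype.val hq)
    obtain ⟨z, hz, hz'⟩ := hT.exists_eq e y (by rw [hy]; exact q.2)
    exact ⟨c, InducedCategory.homMk e, ⟨z, hz⟩, InducedCategory.hom_ext he,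
      Subtype.ext (hz'.trans hy)⟩
  obtain ⟨j, hj⟩ := hG.exists_hom (X := X) (Y := L) (fun a x ↦ ((e a).symm x).1) fun a b f x ↦ by
    obtain ⟨q, rfl⟩ := (e b).surjective x
    have := he (InducedCategory.homMk f) q
    rw [show f ≫ e b q = _ from this.symm, Equiv.symm_apply_apply, Equiv.symm_apply_apply]
    rfl
  refine ⟨X, j, hG.mono_of_injective j fun a x y hxy ↦ ?_, ?_⟩
  · exact (e a).symm.injective (Subtype.ext (by simpa only [hj] using hxy))
  · ext a x
    simp only [mem_homImage, hj]
    exact ⟨by rintro ⟨y, rfl⟩; exact ((e a).symm y).2,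
      fun hx ↦ ⟨e a ⟨x, hx⟩, congr_arg Subtype.val ((e a).symm_apply_apply ⟨x, hx⟩)⟩⟩

lemma exists_quotient (hG : IsFPFamily G) (hT : IsPureSubfunctor T) :
    ∃ (S : C) (c : L ⟶ S), (∀ a (s : G a ⟶ S), ∃ x, x ≫ c = s) ∧
      ∀ a (x : G a ⟶ L), x ≫ c = 0 ↔ x ∈ T a := by
  obtain ⟨S, e, he⟩ := hG.exists_representation hT.quotient fun a b f q hq ↦ by
    obtain ⟨q⟩ := q
    have hq : f.hom ≫ q ∈ T a := (QuotientAddGroup.eq_zero_iff _).1 hq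
    obtain ⟨c, e, he, hc⟩ := hG.exists_weakCokernel f.hom
    obtain ⟨y, hy, hy'⟩ := hT.exists_eq f.hom q hq
    obtain ⟨z, hz⟩ := hc (q - y) (by rw [Preadditive.comp_sub, hy', sub_self])
    refine ⟨c, InducedCategory.homMk e, QuotientAddGroup.mk z, InducedCategory.hom_ext he,
      QuotientAddGroup.eq_iff_sub_mem.2 ?_⟩
    change e ≫ z - q ∈ T b
    rw [hz]
    simpa using neg_mem hy
  obtain ⟨c, hc⟩ := hG.exists_hom (X := L) (Y := S) (fun a x ↦ e a (QuotientAddGroup.mk x))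
    fun a b f x ↦ he (InducedCategory.homMk f) (QuotientAddGroup.mk x)
  refine ⟨S, c, fun a s ↦ ?_, fun a x ↦ ?_⟩
  · obtain ⟨⟨x⟩, rfl⟩ := (e a).surjective s
    exact ⟨x, hc _ _⟩
  · rw [← (zero_comp : (0 : G a ⟶ L) ≫ c = 0), hc, hc]
    exact (e a).injective.eq_iff.trans (QuotientAddGroup.eq_zero_iff x)

end IsPureSubfunctor

variable (G) in
/-- The sequence `K ⟶ L ⟶ S` is pure exact: `Hom(G a, K) ⟶ Hom(G a, L) ⟶ Hom(G a, S)` is exact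
with surjective second map for every `a`. Injectivity of the first map is not part of the notion,
since it is expressed by `Mono h`. -/
structure IsPureExact (h : K ⟶ L) (c : L ⟶ S) : Prop where
  exists_lift ⦃a : A⦄ (s : G a ⟶ S) : ∃ x, x ≫ c = s
  comp_eq_zero_iff ⦃a : A⦄ (x : G a ⟶ L) : x ≫ c = 0 ↔ ∃ y, y ≫ h = x

section

variable [IsLocallyFinitelyPresentable.{w} C] (hG : IsFPFamily G)

include hG

lemma isPureSubfunctor_ker (hc : ∀ a (s : G a ⟶ S), ∃ x, x ≫ c = s) :
    IsPureSubfunctor (fun a ↦ (Preadditive.rightComp (G a) c).ker) where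
  comp_mem a b f x hx := by
    replace hx : x ≫ c = 0 := hx
    exact (Category.assoc f x c).trans (by rw [hx, comp_zero])
  exists_eq a b f x hx := by
    replace hx : (f ≫ x) ≫ c = 0 := hx
    obtain ⟨d, e, he, hd⟩ := hG.exists_weakCokernel f
    obtain ⟨s, hs⟩ := hd (x ≫ c) (by rw [← Category.assoc, hx])
    obtain ⟨z, rfl⟩ := hc d s
    exact ⟨x - e ≫ z, show (x - e ≫ z) ≫ c = 0 by simp [hs], by simp [reassoc_of% he]⟩

omit [Preadditive C] in
lemma epi_of_exists_lift (hc : ∀ a (s : G a ⟶ S), ∃ x, x ≫ c = s) : Epi c where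
  left_cancellation f g e := hG.hom_ext fun a s ↦ by
    obtain ⟨x, rfl⟩ := hc a s
    simp [e]

lemma exists_desc (hc : ∀ a (s : G a ⟶ S), ∃ x, x ≫ c = s) {Z : C} (z : L ⟶ Z)
    (hz : ∀ a (x : G a ⟶ L), x ≫ c = 0 → x ≫ z = 0) : ∃ d : S ⟶ Z, c ≫ d = z := by
  choose y hy using hc
  have comp_eq_of_comp_eq {a : A} (x x' : G a ⟶ L) (e : x ≫ c = x' ≫ c) : x ≫ z = x' ≫ z := by
    rw [← sub_eq_zero, ← Preadditive.sub_comp]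
    exact hz _ _ (by simp [e])
  obtain ⟨d, hd⟩ := hG.exists_hom (fun a s ↦ y a s ≫ z) fun a b f s ↦ by
    rw [← Category.assoc]
    exact comp_eq_of_comp_eq _ _ (by simp [hy])
  exact ⟨d, hG.hom_ext fun a x ↦ by
    rw [← Category.assoc, hd, comp_eq_of_comp_eq _ _ (hy _ _)]⟩

namespace IsPureExact

lemma comp_eq_zero (H : IsPureExact G h c) : h ≫ c = 0 := hG.hom_ext fun a x ↦ by
  rw [comp_zero, ← Category.assoc, H.comp_eq_zero_iff]
  exact ⟨x, rfl⟩

lemma isPure [Mono h] (H : IsPureExact G h c) : IsPure.{w} h := by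
  have : homImage G h = fun a ↦ (Preadditive.rightComp (G a) c).ker := by
    ext a x
    exact (H.comp_eq_zero_iff x).symm
  exact IsPureSubfunctor.isPure hG (this ▸ isPureSubfunctor_ker hG fun _ s ↦ H.exists_lift s)

end IsPureExact

end

end Purity

namespace CategoryTheory.IsPure

open Purity

variable {C : Type u} [Category.{w} C] [Preadditive C] {K L K' L' : C} {h : K ⟶ L}

lemma biprod_inl_comp [HasBinaryBiproducts C] (hh : IsPure.{w} h) {A : Type w} {G : A → C}
    (hG : IsFPFamily G) {k : K ⟶ K'} {S : C} {c : K' ⊞ L ⟶ S}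
    (H : IsPureExact G (biprod.lift (-k) h) c) : IsPure.{w} (biprod.inl ≫ c) :=
  hG.isPure_of_exists_lift fun a b f u v e ↦ by
    obtain ⟨v', rfl⟩ := H.exists_lift v
    obtain ⟨y, hy⟩ := (H.comp_eq_zero_iff (u ≫ biprod.inl - f ≫ v')).1 (by simp [e])
    have hy₁ : -(y ≫ k) = u - f ≫ v' ≫ biprod.fst := by
      simpa [Preadditive.sub_comp] using congr_arg (· ≫ biprod.fst) hy
    have hy₂ : y ≫ h = -(f ≫ v' ≫ biprod.snd) := by
      simpa [Preadditive.sub_comp] using congr_arg (· ≫ biprod.snd) hy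
    obtain ⟨g, rfl⟩ := hh (hG.isFinitelyPresentable a) (hG.isFinitelyPresentable b) f y
      (-(v' ≫ biprod.snd)) (by simpa using hy₂)
    refine ⟨v' ≫ biprod.fst - g ≫ k, ?_⟩
    rw [Preadditive.comp_sub, ← Category.assoc f g k, sub_eq_add_neg, hy₁, add_sub_cancel]

variable [IsLocallyFinitelyPresentable.{w} C]

lemma mono [HasZeroObject C] (hh : IsPure.{w} h) : Mono h := by
  obtain ⟨A, G, hG⟩ := exists_isFPFamily (C := C)
  refine hG.mono_of_injective h fun a x y e ↦ ?_
  obtain ⟨Z, hZ⟩ := HasZeroObject.zero (C := C)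
  obtain ⟨g, hg⟩ := hh (hG.isFinitelyPresentable a)
    (isFinitelyPresentable_of_isZero hZ) 0 (x - y) 0 (by simpa [sub_eq_zero] using e)
  rw [← sub_eq_zero, ← hg, zero_comp]

variable [HasFiniteBiproducts C]

lemma exists_isPureExact (hh : IsPure.{w} h) {A : Type w} {G : A → C} (hG : IsFPFamily G) :
    ∃ (S : C) (c : L ⟶ S), IsPureExact G h c := by
  obtain ⟨S, c, h₁, h₂⟩ := (IsPureSubfunctor.of_isPure hG hh).exists_quotient hG
  exact ⟨S, c, h₁, h₂⟩

-- The pushout maps to the quotient `S` of `K' ⊞ L` by the pure subobject `K`.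
lemma of_isPushout {k : K ⟶ K'} {h' : K' ⟶ L'} {k' : L ⟶ L'} (sq : IsPushout k h h' k')
    (hh : IsPure.{w} h) : IsPure.{w} h' := by
  obtain ⟨A, G, hG⟩ := exists_isFPFamily (C := C)
  have := hasBinaryBiproducts_of_finite_biproducts C
  have lift_isPure : IsPure.{w} (biprod.lift (-k) h) :=
    of_comp (h' := biprod.snd) (by simpa using hh)
  obtain ⟨S, c, H⟩ := lift_isPure.exists_isPureExact hG
  have hc : k ≫ biprod.inl ≫ c = h ≫ biprod.inr ≫ c := by
    simpa [biprod.lift_eq, neg_add_eq_zero] using H.comp_eq_zero hG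
  refine of_comp (h' := sq.desc (biprod.inl ≫ c) (biprod.inr ≫ c) hc) ?_
  rw [sq.inl_desc]
  exact hh.biprod_inl_comp hG H

end CategoryTheory.IsPure

namespace Purity

section

variable {C : Type u} [Category.{w} C] [Preadditive C] [HasFiniteBiproducts C]
  [IsLocallyFinitelyPresentable.{w} C]

variable (C) in
lemma isCofibrantlyClosed_pureMonomorphisms :
    MorphismProperty.IsCofibrantlyClosed.{w} (MorphismProperty.pureMonomorphisms.{w} C) := by
  have := hasZeroObject_of_hasFiniteBiproducts C
  have mem_of_isPure {K L : C} {h : K ⟶ L} (hh : IsPure.{w} h) :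
    MorphismProperty.pureMonomorphisms.{w} C h := ⟨hh, hh.mono⟩
  have isStableUnderCobaseChange :
      (MorphismProperty.pureMonomorphisms.{w} C).IsStableUnderCobaseChange :=
    ⟨fun sq hf ↦ mem_of_isPure (hf.1.of_isPushout sq)⟩
  have : (MorphismProperty.pureMonomorphisms.{w} C).IsMultiplicative :=
    { id_mem X := mem_of_isPure (.of_isIso (h := 𝟙 X))
      comp_mem _ _ hf hg := mem_of_isPure (hf.1.comp hg.1) }
  have : MorphismProperty.IsStableUnderFilteredColimits.{w, w}
      (MorphismProperty.pureMonomorphisms.{w} C) :=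
    { isStableUnderColimitsOfShape J _ _ := ⟨fun _ _ _ _ hc hc' f hf φ hφ ↦
        mem_of_isPure (.of_isColimit hc hc' f (fun j ↦ (hf j).1) φ hφ)⟩ }
  exact ⟨isStableUnderCobaseChange, inferInstance,
    ⟨fun r hg ↦ mem_of_isPure (.of_retractArrow r hg.1)⟩⟩

end

section

variable {C : Type u} [Category.{w} C] [Preadditive C] {A : Type w} {G : A → C}
  {K L S N P : C} {h : K ⟶ L} {c : L ⟶ S} {k : N ⟶ P} {π : P ⟶ S}

namespace IsPureExact

lemma comp_iso (H : IsPureExact G h c) {S' : C} (e : S ≅ S') : IsPureExact G h (c ≫ e.hom) where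
  exists_lift a s := by
    obtain ⟨x, hx⟩ := H.exists_lift (s ≫ e.inv)
    exact ⟨x, by simp [reassoc_of% hx]⟩
  comp_eq_zero_iff a x := by
    rw [← H.comp_eq_zero_iff, ← Category.assoc, Preadditive.IsIso.comp_right_eq_zero]

lemma exists_comp_biprod_desc_eq [HasBinaryBiproducts C] (H : IsPureExact G h c)
    (H' : IsPureExact G k π) {l : P ⟶ L} (hl : l ≫ c = π) {a : A} (x : G a ⟶ L) :
    ∃ z, z ≫ biprod.desc h l = x := by
  obtain ⟨y, hy⟩ := H'.exists_lift (x ≫ c)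
  obtain ⟨z, hz⟩ := (H.comp_eq_zero_iff (x - y ≫ l)).1 (by simp [hl, hy])
  exact ⟨biprod.lift z y, by simp [hz]⟩

variable [IsLocallyFinitelyPresentable.{w} C] (hG : IsFPFamily G)

include hG

lemma isPushout [HasBinaryBiproducts C] [Mono h] (H : IsPureExact G h c)
    (H' : IsPureExact G k π) {l : P ⟶ L} (hl : l ≫ c = π) {t : N ⟶ K} (ht : t ≫ h = k ≫ l) :
    IsPushout t k h l := by
  have hlift a (x : G a ⟶ L) := H.exists_comp_biprod_desc_eq H' hl x
  have := epi_of_exists_lift hG hlift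
  have hdesc (s : PushoutCocone t k) :
      ∃ d : L ⟶ s.pt, biprod.desc h l ≫ d = biprod.desc s.inl s.inr := by
    refine exists_desc hG hlift _ fun a x hx ↦ ?_
    obtain ⟨q, p, rfl⟩ : ∃ q p, x = biprod.lift q p :=
      ⟨x ≫ biprod.fst, x ≫ biprod.snd, by ext <;> simp⟩
    rw [biprod.lift_desc] at hx ⊢
    obtain ⟨y, rfl⟩ := (H'.comp_eq_zero_iff p).1
      (by simpa [hl, H.comp_eq_zero hG] using congr_arg (· ≫ c) hx)
    obtain rfl : q = -(y ≫ t) := by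
      rw [← cancel_mono h, eq_neg_iff_add_eq_zero.2 hx]
      simp [ht]
    simp [s.condition]
  choose d hd using hdesc
  have hd₁ (s) : h ≫ d s = s.inl := by simpa using biprod.inl ≫= hd s
  have hd₂ (s) : l ≫ d s = s.inr := by simpa using biprod.inr ≫= hd s
  refine ⟨⟨ht⟩, ⟨PushoutCocone.IsColimit.mk _ d hd₁ hd₂ fun s m h₁ h₂ ↦ ?_⟩⟩
  rw [← cancel_epi (biprod.desc h l)]
  ext <;> simp [h₁, h₂, hd₁, hd₂]

lemma exists_isPushout [HasBinaryBiproducts C] [Mono h] (H : IsPureExact G h c)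
    (H' : IsPureExact G k π) {l : P ⟶ L} (hl : l ≫ c = π) : ∃ t : N ⟶ K, IsPushout t k h l := by
  obtain ⟨t, ht⟩ := hG.exists_lift (k ≫ l) h fun a x ↦
    (H.comp_eq_zero_iff _).1 (by simp [hl, H'.comp_eq_zero hG])
  exact ⟨t, H.isPushout hG H' hl ht⟩

end IsPureExact

variable [HasFiniteBiproducts C] [IsLocallyFinitelyPresentable.{w} C]

lemma exists_isPureExact_projective (hG : IsFPFamily G) (S : C) :
    ∃ (N P : C) (k : N ⟶ P) (π : P ⟶ S), Mono k ∧ IsPureExact G k π ∧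
      ∀ ⦃L : C⦄ (c : L ⟶ S), (∀ a (s : G a ⟶ S), ∃ x, x ≫ c = s) → ∃ l : P ⟶ L, l ≫ c = π := by
  let π : (∐ fun i : Σ a, (G a ⟶ S) ↦ G i.1) ⟶ S := Limits.Sigma.desc fun i ↦ i.2
  have hπ a (s : G a ⟶ S) : ∃ x, x ≫ π = s :=
    ⟨Limits.Sigma.ι (fun i : Σ a, (G a ⟶ S) ↦ G i.1) ⟨a, s⟩, by simp [π]⟩
  obtain ⟨N, k, hk, hk'⟩ := (isPureSubfunctor_ker hG hπ).exists_mono hG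
  refine ⟨N, _, k, π, hk, ⟨hπ, fun a x ↦ ?_⟩, fun L c hc ↦ ?_⟩
  · exact (SetLike.ext_iff.1 (congr_fun hk' a) x).symm
  · choose y hy using hc
    exact ⟨Limits.Sigma.desc fun i ↦ y i.1 i.2, Limits.Sigma.hom_ext _ _ fun i ↦ by simp [hy, π]⟩

-- One morphism for each `κ`-presentable `S`: the kernel of a pure epimorphism onto `S` whose
-- source is projective with respect to pure epimorphisms.
lemma exists_isSmall_le_pureMonomorphisms (hG : IsFPFamily G) (κ : Cardinal.{w})
    [Fact κ.IsRegular] :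
    ∃ X : MorphismProperty C, MorphismProperty.IsSmall.{w} X ∧
      X ≤ MorphismProperty.pureMonomorphisms.{w} C ∧
      ∀ ⦃K L S : C⦄ (h : K ⟶ L) (c : L ⟶ S) [Mono h] [IsCardinalPresentable S κ],
        IsPureExact G h c → X.pushouts h := by
  have : Fact Cardinal.aleph0.{w}.IsRegular := Cardinal.fact_isRegular_aleph0
  have := IsCardinalLocallyPresentable.of_le C (κ := Cardinal.aleph0.{w})
    (Cardinal.IsRegular.aleph0_le (c := κ) Fact.out)
  have := hasBinaryBiproducts_of_finite_biproducts C
  obtain ⟨Q, _, -, hQ⟩ := ObjectProperty.EssentiallySmall.exists_small_le.{w}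
    (isCardinalPresentable C κ)
  choose N P k π hk H hP using exists_isPureExact_projective hG
  refine ⟨MorphismProperty.ofHoms fun S : Subtype Q ↦ k S.1, inferInstance, ?_, ?_⟩
  · rintro _ _ _ ⟨S⟩
    exact ⟨(H S.1).isPure hG, hk S.1⟩
  · intro K L S h c _ hS E
    obtain ⟨S', hS', ⟨e⟩⟩ := hQ S hS
    obtain ⟨l, hl⟩ := hP S' (c ≫ e.hom) fun _ s ↦ (E.comp_iso e).exists_lift s
    obtain ⟨t, ht⟩ := (E.comp_iso e).exists_isPushout hG (H S') hl
    exact MorphismProperty.pushouts_mk _ ht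
      (MorphismProperty.ofHoms.mk (i := (⟨S', hS'⟩ : Subtype Q)))

end

/-! ### Small pure subfunctors -/

section

variable {C : Type u} [Category.{w} C] [Preadditive C] {A : Type w} {G : A → C} {L : C}

/-- One step in the construction of `pureClosure`: sums, composites, and a chosen solution of every
solvable equation `f ≫ x = y` with `y` in `U`. It contains `U` because of the composites with
identities. -/
def pureClosureStep (U : ∀ a, Set (G a ⟶ L)) (a : A) : Set (G a ⟶ L) :=
  {0} ∪ Set.image2 (· + ·) (U a) (U a) ∪ (⋃ b, ⋃ f : G a ⟶ G b, (f ≫ ·) '' U b) ∪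
    ⋃ b, ⋃ f : G b ⟶ G a, Function.invFun (f ≫ ·) '' U b

section pureClosureStep

variable {U : ∀ a, Set (G a ⟶ L)} {a b : A}

lemma zero_mem_pureClosureStep : 0 ∈ pureClosureStep U a := .inl (.inl (.inl rfl))

lemma add_mem_pureClosureStep {x y : G a ⟶ L} (hx : x ∈ U a) (hy : y ∈ U a) :
    x + y ∈ pureClosureStep U a :=
  .inl (.inl (.inr (Set.mem_image2_of_mem hx hy)))

lemma comp_mem_pureClosureStep (f : G a ⟶ G b) {x : G b ⟶ L} (hx : x ∈ U b) :
    f ≫ x ∈ pureClosureStep U a :=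
  .inl (.inr (Set.mem_iUnion₂_of_mem (i := b) (j := f) ⟨x, hx, rfl⟩))

lemma exists_mem_pureClosureStep (f : G a ⟶ G b) (x : G b ⟶ L) (hx : f ≫ x ∈ U a) :
    ∃ y ∈ pureClosureStep U b, f ≫ y = f ≫ x :=
  ⟨Function.invFun (f ≫ ·) (f ≫ x), .inr (Set.mem_iUnion₂_of_mem (i := a) (j := f) ⟨_, hx, rfl⟩),
    Function.invFun_eq (f := (f ≫ ·)) ⟨x, rfl⟩⟩

lemma id_le_pureClosureStep : id ≤ pureClosureStep (G := G) (L := L) := fun U a x hx ↦ by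
  simpa using comp_mem_pureClosureStep (𝟙 (G a)) hx

lemma monotone_iterate_pureClosureStep (U : ∀ a, Set (G a ⟶ L)) (a : A) :
    Monotone fun n ↦ (pureClosureStep^[n] U) a :=
  fun _ _ h ↦ Function.monotone_iterate_of_id_le id_le_pureClosureStep h U a

variable {κ : Cardinal.{w}} [Fact κ.IsRegular]

omit [Preadditive C] [Fact κ.IsRegular] in
lemma hasCardinalLT_hom (hκ : HasCardinalLT (Arrow (InducedCategory C G)) κ)
    (a b : InducedCategory C G) : HasCardinalLT (G a ⟶ G b) κ :=
  hκ.of_injective (fun f ↦ Arrow.mk (InducedCategory.homMk f : a ⟶ b)) fun _ _ h ↦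
    congr_arg InducedCategory.Hom.hom ((Arrow.mk_inj a b).1 h)

lemma hasCardinalLT_pureClosureStep (hκ : HasCardinalLT (Arrow (InducedCategory C G)) κ)
    (hU : ∀ a, HasCardinalLT (U a) κ) (a : A) : HasCardinalLT (pureClosureStep U a) κ := by
  have aleph0_le : Cardinal.aleph0 ≤ κ := Cardinal.IsRegular.aleph0_le Fact.out
  have hA : HasCardinalLT A κ := hasCardinalLT_of_hasCardinalLT_arrow (C := InducedCategory C G) hκ
  have image {a b : A} (f : (G a ⟶ L) → (G b ⟶ L)) : HasCardinalLT (f '' U a) κ :=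
    (hU a).of_surjective _ Set.imageFactorization_surjective
  refine hasCardinalLT_union aleph0_le (hasCardinalLT_union aleph0_le (hasCardinalLT_union aleph0_le
    (hasCardinalLT_of_finite _ κ aleph0_le) ?_) ?_) ?_
  · rw [← Set.image_prod]
    exact (hasCardinalLT_prod aleph0_le (hU a) (hU a)).of_surjective _
      (Set.imageFactorization_surjective.comp (Equiv.Set.prod _ _).symm.surjective)
  · exact hasCardinalLT_iUnion _ hA fun b ↦
      hasCardinalLT_iUnion _ (hasCardinalLT_hom hκ a b) fun f ↦ image _
  · exact hasCardinalLT_iUnion _ hA fun b ↦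
      hasCardinalLT_iUnion _ (hasCardinalLT_hom hκ b a) fun f ↦ image _

end pureClosureStep

/-- A pure subfunctor containing the family of sets `U`, whose cardinality is controlled by those
of `U` and of the category `InducedCategory C G`. -/
def pureClosure (U : ∀ a, Set (G a ⟶ L)) (a : A) : AddSubgroup (G a ⟶ L) where
  carrier := ⋃ n : ℕ, (pureClosureStep^[n] U) a
  zero_mem' := Set.mem_iUnion_of_mem 1 zero_mem_pureClosureStep
  add_mem' {x y} hx hy := by
    obtain ⟨m, hm⟩ := Set.mem_iUnion.1 hx
    obtain ⟨n, hn⟩ := Set.mem_iUnion.1 hy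
    refine Set.mem_iUnion_of_mem (max m n + 1) ?_
    rw [Function.iterate_succ_apply']
    exact add_mem_pureClosureStep
      (monotone_iterate_pureClosureStep U a (le_max_left m n) hm)
      (monotone_iterate_pureClosureStep U a (le_max_right m n) hn)
  neg_mem' {x} hx := by
    obtain ⟨n, hn⟩ := Set.mem_iUnion.1 hx
    refine Set.mem_iUnion_of_mem (n + 1) ?_
    rw [Function.iterate_succ_apply']
    simpa using comp_mem_pureClosureStep (-𝟙 (G a)) hn

section pureClosure

variable (U : ∀ a, Set (G a ⟶ L))

lemma mem_pureClosure {a : A} {x : G a ⟶ L} :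
    x ∈ pureClosure U a ↔ ∃ n, x ∈ (pureClosureStep^[n] U) a :=
  Set.mem_iUnion

lemma subset_pureClosure (a : A) : U a ⊆ pureClosure U a :=
  fun _ hx ↦ Set.mem_iUnion_of_mem 0 hx

lemma isPureSubfunctor_pureClosure : IsPureSubfunctor (pureClosure U) where
  comp_mem a b f x hx := by
    obtain ⟨n, hn⟩ := (mem_pureClosure U).1 hx
    refine (mem_pureClosure U).2 ⟨n + 1, ?_⟩
    rw [Function.iterate_succ_apply']
    exact comp_mem_pureClosureStep f hn
  exists_eq a b f x hx := by
    obtain ⟨n, hn⟩ := (mem_pureClosure U).1 hx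
    obtain ⟨y, hy, e⟩ := exists_mem_pureClosureStep f x hn
    refine ⟨y, (mem_pureClosure U).2 ⟨n + 1, ?_⟩, e⟩
    rwa [Function.iterate_succ_apply']

variable {U} {κ : Cardinal.{w}} [Fact κ.IsRegular]

lemma hasCardinalLT_pureClosure (hℕ : HasCardinalLT ℕ κ)
    (hκ : HasCardinalLT (Arrow (InducedCategory C G)) κ) (hU : ∀ a, HasCardinalLT (U a) κ)
    (a : A) : HasCardinalLT (pureClosure U a) κ := by
  have hasCardinalLT_iterate (n : ℕ) : ∀ a, HasCardinalLT ((pureClosureStep^[n] U) a) κ := by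
    induction n with
    | zero => exact hU
    | succ n ih =>
      rw [Function.iterate_succ_apply']
      exact hasCardinalLT_pureClosureStep hκ ih
  exact hasCardinalLT_iUnion _ hℕ fun n ↦ hasCardinalLT_iterate n a

end pureClosure

end

section

variable {C : Type u} [Category.{w} C] [Preadditive C] [IsLocallyFinitelyPresentable.{w} C]
  {A : Type w} {G : A → C} {L S₀ : C} {c : L ⟶ S₀}

lemma IsPureSubfunctor.comap {U : ∀ a, AddSubgroup (G a ⟶ S₀)} (hU : IsPureSubfunctor U)
    (hG : IsFPFamily G) (hc : ∀ a (s : G a ⟶ S₀), ∃ x, x ≫ c = s) :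
    IsPureSubfunctor fun a ↦ (U a).comap (Preadditive.rightComp (G a) c) where
  comp_mem a b f x hx := by
    replace hx : x ≫ c ∈ U b := hx
    change (f ≫ x) ≫ c ∈ U a
    rw [Category.assoc]
    exact hU.comp_mem f hx
  exists_eq a b f x hx := by
    replace hx : (f ≫ x) ≫ c ∈ U a := hx
    obtain ⟨s, hy, hy'⟩ := hU.exists_eq f (x ≫ c) (by rwa [← Category.assoc])
    obtain ⟨y, rfl⟩ := hc b s
    obtain ⟨z, hz : z ≫ c = 0, hz'⟩ := (isPureSubfunctor_ker hG hc).exists_eq f (x - y)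
      (show (f ≫ (x - y)) ≫ c = 0 by simp [hy'])
    exact ⟨y + z, show (y + z) ≫ c ∈ U b by simpa [hz] using hy, by simp [hz']⟩

lemma IsPureExact.exists_of_comp {X X' S : C} {k : X ⟶ X'} {j : X' ⟶ L} [Mono j]
    (H : IsPureExact G (k ≫ j) c) (hG : IsFPFamily G) (i : S ⟶ S₀) [Mono i]
    (hj : ∀ a (x : G a ⟶ L), (∃ y, y ≫ j = x) ↔ ∃ s, s ≫ i = x ≫ c) :
    ∃ q : X' ⟶ S, IsPureExact G k q := by
  obtain ⟨q, hq⟩ := hG.exists_lift (j ≫ c) i fun a x ↦ by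
    simpa using (hj a (x ≫ j)).1 ⟨x, rfl⟩
  refine ⟨q, fun a s ↦ ?_, fun a x ↦ ?_⟩
  · obtain ⟨x, hx⟩ := H.exists_lift (s ≫ i)
    obtain ⟨y, rfl⟩ := (hj a x).2 ⟨s, hx.symm⟩
    exact ⟨y, by simpa [← cancel_mono i, hq] using hx⟩
  · rw [← cancel_mono i, zero_comp, Category.assoc, hq, ← Category.assoc, H.comp_eq_zero_iff]
    simp [← cancel_mono j]

end

section

variable {C : Type u} [Category.{w} C] [Preadditive C] {A : Type w} {G : A → C} {L : C}

/-- The quotient of the pure subfunctor `T'` of `Hom(-, L)` by the pure subfunctor `T` is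
represented by a `κ`-presentable object. This is formulated as a property of the objects `X` and
`X'` representing `T` and `T'`. -/
def IsPresentableStep (κ : Cardinal.{w}) [Fact κ.IsRegular]
    (T T' : ∀ a, AddSubgroup (G a ⟶ L)) : Prop :=
  ∀ ⦃X X' : C⦄ (k : X ⟶ X') (j : X' ⟶ L) [Mono j],
    homImage G (k ≫ j) = T → homImage G j = T' →
      ∃ (S : C) (q : X' ⟶ S), IsCardinalPresentable S κ ∧ IsPureExact G k q

variable [HasFiniteBiproducts C] [IsLocallyFinitelyPresentable.{w} C]

-- `T'` is the preimage in `L` of a small pure subfunctor of the quotient of `L` by `T`.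
lemma IsPureSubfunctor.exists_lt {T : ∀ a, AddSubgroup (G a ⟶ L)} (hT : IsPureSubfunctor T)
    (hG : IsFPFamily G) {κ : Cardinal.{w}} [Fact κ.IsRegular] (hℕ : HasCardinalLT ℕ κ)
    (hκ : HasCardinalLT (Arrow (InducedCategory C G)) κ) (hT' : T ≠ ⊤) :
    ∃ T' : ∀ a, AddSubgroup (G a ⟶ L), IsPureSubfunctor T' ∧ T < T' ∧
      IsPresentableStep κ T T' := by
  obtain ⟨S₀, c, hc, hcT⟩ := hT.exists_quotient hG
  obtain ⟨b, x, hx⟩ : ∃ b, ∃ x : G b ⟶ L, x ∉ T b := by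
    by_contra! H
    exact hT' (funext fun b ↦ (AddSubgroup.eq_top_iff' _).2 (H b))
  let U := pureClosure fun a ↦ Set.range fun f : G a ⟶ G b ↦ f ≫ x ≫ c
  have hU : IsPureSubfunctor U := isPureSubfunctor_pureClosure _
  have x_mem : x ≫ c ∈ U b := subset_pureClosure _ _ ⟨𝟙 _, by simp⟩
  have hU_lt (a : A) : HasCardinalLT (U a) κ := hasCardinalLT_pureClosure hℕ hκ (fun a ↦
    (hasCardinalLT_hom hκ a b).of_surjective _ Set.rangeFactorization_surjective) a
  obtain ⟨S, i, _, hi⟩ := hU.exists_mono hG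
  have hS : IsCardinalPresentable S κ := hG.isCardinalPresentable κ hκ fun a ↦
    (hU_lt a).of_injective (fun s ↦ ⟨s ≫ i, by rw [← hi]; exact ⟨s, rfl⟩⟩) fun s t h ↦ by
      simpa [cancel_mono] using h
  refine ⟨fun a ↦ (U a).comap (Preadditive.rightComp (G a) c), hU.comap hG hc,
    lt_of_le_not_ge (fun a y hy ↦ ?_) fun H ↦ hx (H b x_mem), fun X X' k j _ hkj hj ↦ ?_⟩
  · change y ≫ c ∈ U a
    rw [(hcT a y).2 hy]
    exact zero_mem _
  · have H : IsPureExact G (k ≫ j) c := ⟨hc, fun a y ↦ by rw [hcT, ← hkj, mem_homImage]⟩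
    obtain ⟨q, hq⟩ := H.exists_of_comp hG i fun a y ↦ by
      rw [← mem_homImage, hj, ← mem_homImage, hi]
      rfl
    exact ⟨S, q, hS, hq⟩

end

/-! ### Continuous chains -/

section

variable {I : Type*} [CompleteLattice I] {J : Type w} [LinearOrder J] [SuccOrder J]
  [WellFoundedLT J]

lemma transfiniteIterate_induction [OrderBot J] {φ : I → I} {p : I → Prop} (hφ : ∀ x, x ≤ φ x)
    (hsup : ∀ ⦃ι : Type w⦄ [LinearOrder ι] [Nonempty ι] (f : ι → I), Monotone f →
      (∀ i, p (f i)) → p (⨆ i, f i))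
    (hp : ∀ x, p x → p (φ x)) {x₀ : I} (h₀ : p x₀) (j : J) : p (transfiniteIterate φ j x₀) := by
  induction j using SuccOrder.limitRecOn with
  | isMin j hj =>
    obtain rfl := hj.eq_bot
    rwa [transfiniteIterate_bot]
  | succ j hj ih =>
    rw [transfiniteIterate_succ _ _ _ hj]
    exact hp _ ih
  | isSuccLimit j hj ih =>
    rw [transfiniteIterate_limit _ _ _ hj]
    have := hj.nonempty_Iio.to_subtype
    exact hsup _ (fun i k hik ↦ monotone_transfiniteIterate φ x₀ hφ hik) fun i ↦ ih i.1 i.2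

lemma transfiniteIterate_limit_Iic (φ : I → I) (x₀ : I) (m : J) {k : Set.Iic m}
    (hk : Order.IsSuccLimit k) :
    transfiniteIterate φ k.1 x₀ = ⨆ i : Set.Iio k, transfiniteIterate φ i.1.1 x₀ := by
  have hk' : Order.IsSuccLimit k.1 := (Set.initialSegIic m).map_isSuccLimit hk
  rw [transfiniteIterate_limit _ _ _ hk']
  exact le_antisymm
    (iSup_le fun i ↦ le_iSup (fun i : Set.Iio k ↦ transfiniteIterate φ i.1.1 x₀)
      ⟨⟨i.1, i.2.le.trans k.2⟩, i.2⟩)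
    (iSup_le fun i ↦ le_iSup (fun i : Set.Iio k.1 ↦ transfiniteIterate φ i.1 x₀) ⟨i.1.1, i.2⟩)

end

/-- A monotone family, in applications indexed by a well-ordered type, whose steps satisfy the
relation `r` and which is continuous at limit elements. -/
structure IsContinuousChain {I J : Type*} [CompleteLattice I] [LinearOrder J] [SuccOrder J]
    (r : I → I → Prop) (f : J → I) : Prop where
  monotone : Monotone f
  step (j : J) : ¬ IsMax j → r (f j) (f (Order.succ j))
  eq_iSup (j : J) : Order.IsSuccLimit j → f j = ⨆ i : Set.Iio j, f i

open Classical in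
lemma exists_isContinuousChain {I : Type w} [CompleteLattice I] {p : I → Prop}
    {r : I → I → Prop}
    (hsup : ∀ ⦃ι : Type w⦄ [LinearOrder ι] [Nonempty ι] (f : ι → I), Monotone f →
      (∀ i, p (f i)) → p (⨆ i, f i))
    (hr : ∀ x, p x → x ≠ ⊤ → ∃ y, p y ∧ x < y ∧ r x y) {x₀ : I} (h₀ : p x₀) :
    ∃ (J : Type w) (_ : LinearOrder J) (_ : BoundedOrder J) (_ : SuccOrder J)
      (_ : WellFoundedLT J) (f : J → I), IsContinuousChain r f ∧ (∀ j, p (f j)) ∧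
        f ⊥ = x₀ ∧ f ⊤ = ⊤ := by
  choose! ψ hψp hψlt hψr using hr
  let φ (x : I) : I := if p x ∧ x ≠ ⊤ then ψ x else ⊤
  have φ_top : φ ⊤ = ⊤ := if_neg (by simp)
  have lt_φ (x : I) (hx : x ≠ ⊤) : x < φ x := by
    dsimp only [φ]
    split_ifs with h
    exacts [hψlt x h.1 h.2, hx.lt_top]
  have le_φ (x : I) : x ≤ φ x := by
    obtain rfl | hx := eq_or_ne x ⊤
    exacts [φ_top.ge, (lt_φ x hx).le]
  have p_φ (x : I) (hx : p x) : p (φ x) := by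
    obtain rfl | hx' := eq_or_ne x ⊤
    · rwa [φ_top]
    · simpa only [φ, if_pos (And.intro hx hx')] using hψp x hx hx'
  let J := (Order.succ (Cardinal.mk I)).ord.ToType
  have : Nonempty J := by simp [J]
  let : OrderBot J := WellFoundedLT.toOrderBot J
  have hp (j : J) := transfiniteIterate_induction le_φ hsup p_φ h₀ j
  have exists_eq_top : ∃ m : J, transfiniteIterate φ m x₀ = ⊤ :=
    top_mem_range_transfiniteIterate φ x₀ lt_φ φ_top fun hinj ↦
      (Order.lt_succ (Cardinal.mk I)).not_ge
        (by simpa [J] using! Cardinal.mk_le_of_injective hinj)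
  obtain ⟨m, hm, hmin⟩ := WellFounded.has_min (wellFounded_lt (α := J))
    {m : J | transfiniteIterate φ m x₀ = ⊤} exists_eq_top
  refine ⟨Set.Iic m, inferInstance, { }, inferInstance, inferInstance,
    fun j ↦ transfiniteIterate φ j.1 x₀, ⟨?_, ?_, ?_⟩, fun j ↦ hp j.1,
    transfiniteIterate_bot φ x₀, hm⟩
  · exact fun i j hij ↦ monotone_transfiniteIterate φ x₀ le_φ hij
  · intro j hj
    have ne_top : transfiniteIterate φ j.1 x₀ ≠ ⊤ := fun h ↦
      hmin j.1 h (lt_of_le_of_ne j.2 fun h ↦ hj fun k _ ↦ Subtype.coe_le_coe.1 (k.2.trans h.ge))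
    rw [Set.Iic.coe_succ_of_not_isMax hj, transfiniteIterate_succ _ _ _ (Set.not_isMax_coe _ hj)]
    simpa only [φ, if_pos (And.intro (hp j.1) ne_top)] using hψr _ (hp j.1) ne_top
  · exact fun j hj ↦ transfiniteIterate_limit_Iic φ x₀ m hj

section

variable {C : Type u} [Category.{w} C] {A : Type w} {G : A → C}

lemma IsFPFamily.nonempty_isColimit [IsLocallyFinitelyPresentable.{w} C] (hG : IsFPFamily G)
    {J : Type*} [Category* J] [IsFiltered J] {F : J ⥤ C} (c : Cocone F) [∀ j, Mono (c.ι.app j)]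
    (hc : ∀ a (x : G a ⟶ c.pt), ∃ j y, y ≫ c.ι.app j = x) : Nonempty (IsColimit c) := by
  choose i y hy using hc
  have comp_eq_of_comp_eq (s : Cocone F) {a : A} {j k : J} (p : G a ⟶ F.obj j)
      (q : G a ⟶ F.obj k) (hpq : p ≫ c.ι.app j = q ≫ c.ι.app k) :
      p ≫ s.ι.app j = q ≫ s.ι.app k := by
    have : p ≫ F.map (IsFiltered.leftToMax j k) = q ≫ F.map (IsFiltered.rightToMax j k) := by
      simpa [← cancel_mono (c.ι.app (IsFiltered.max j k))] using hpq
    rw [← s.w (IsFiltered.leftToMax j k), ← s.w (IsFiltered.rightToMax j k), reassoc_of% this]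
  choose d hd using fun s : Cocone F ↦ hG.exists_hom (X := c.pt) (Y := s.pt)
    (fun a x ↦ y a x ≫ s.ι.app _) fun a b f x ↦ by
      rw [← Category.assoc]
      exact comp_eq_of_comp_eq s _ _ (by simp [hy])
  exact ⟨{
    desc := d
    fac s j := hG.hom_ext fun a x ↦ by
      rw [← Category.assoc, hd]
      exact comp_eq_of_comp_eq s _ _ (hy _ _)
    uniq s m hm := hG.hom_ext fun a x ↦ by
      rw [hd, ← hm, reassoc_of% (hy a x)] }⟩

lemma mono_map_of_mono_app {J : Type*} [Category* J] {F : J ⥤ C} {L : C}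
    (ι : F ⟶ (Functor.const J).obj L) [∀ j, Mono (ι.app j)] {i j : J} (f : i ⟶ j) :
    Mono (F.map f) :=
  mono_of_mono_fac (h := ι.app i) (by simp : F.map f ≫ ι.app j = ι.app i)

end

variable {C : Type u} [Category.{w} C] [Preadditive C] {A : Type w} {G : A → C} {K K' L : C}

lemma mem_iSup_apply {ι : Type*} [Preorder ι] [IsDirectedOrder ι] [Nonempty ι]
    {T : ι → ∀ a, AddSubgroup (G a ⟶ L)} (hT : Monotone T) {a : A} {x : G a ⟶ L} :
    x ∈ (⨆ i, T i) a ↔ ∃ i, x ∈ T i a := by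
  rw [iSup_apply]
  exact AddSubgroup.mem_iSup_of_directed (Monotone.directed_le fun _ _ hij ↦ hT hij a)

lemma isPureSubfunctor_iSup {ι : Type*} [Preorder ι] [IsDirectedOrder ι] [Nonempty ι]
    {T : ι → ∀ a, AddSubgroup (G a ⟶ L)} (hT : Monotone T)
    (hT' : ∀ i, IsPureSubfunctor (T i)) : IsPureSubfunctor (⨆ i, T i) where
  comp_mem a b f x hx := by
    obtain ⟨i, hi⟩ := (mem_iSup_apply hT).1 hx
    exact (mem_iSup_apply hT).2 ⟨i, (hT' i).comp_mem f hi⟩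
  exists_eq a b f x hx := by
    obtain ⟨i, hi⟩ := (mem_iSup_apply hT).1 hx
    obtain ⟨y, hy, hy'⟩ := (hT' i).exists_eq f x hi
    exact ⟨y, (mem_iSup_apply hT).2 ⟨i, hy⟩, hy'⟩

section

variable [IsLocallyFinitelyPresentable.{w} C] (hG : IsFPFamily G)

include hG

lemma exists_comp_eq_of_homImage_le {h : K ⟶ L} {j : K' ⟶ L} [Mono j]
    (hle : homImage G h ≤ homImage G j) : ∃ k : K ⟶ K', k ≫ j = h :=
  hG.exists_lift h j fun a x ↦ hle a ⟨x, rfl⟩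

lemma exists_iso_of_homImage_eq {h : K ⟶ L} {j : K' ⟶ L} [Mono h] [Mono j]
    (heq : homImage G h = homImage G j) : ∃ e : K ≅ K', e.hom ≫ j = h := by
  obtain ⟨p, hp⟩ := exists_comp_eq_of_homImage_le hG heq.le
  obtain ⟨q, hq⟩ := exists_comp_eq_of_homImage_le hG heq.ge
  exact ⟨⟨p, q, by simp [← cancel_mono h, hp, hq], by simp [← cancel_mono j, hp, hq]⟩, hp⟩

lemma isIso_of_homImage_eq_top {j : K ⟶ L} [Mono j] (hj : homImage G j = ⊤) : IsIso j := by
  obtain ⟨p, hp⟩ := exists_comp_eq_of_homImage_le hG (h := 𝟙 L) (le_top.trans hj.ge)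
  exact ⟨p, by simp [← cancel_mono j, hp], hp⟩

lemma exists_diagram [HasFiniteBiproducts C] {J : Type*} [Preorder J]
    {T : J → ∀ a, AddSubgroup (G a ⟶ L)} (hT : Monotone T) (hT' : ∀ j, IsPureSubfunctor (T j)) :
    ∃ (F : J ⥤ C) (ι : F ⟶ (Functor.const J).obj L),
      ∀ j, Mono (ι.app j) ∧ homImage G (ι.app j) = T j := by
  choose X ι _ hι using fun j ↦ (hT' j).exists_mono hG
  choose l hl using fun {i j : J} (f : i ⟶ j) ↦
    exists_comp_eq_of_homImage_le hG ((hι i).trans_le ((hT (leOfHom f)).trans (hι j).ge))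
  exact ⟨{ obj := X
           map := l
           map_id j := by simp [← cancel_mono (ι j), hl]
           map_comp {i j k} f g := by simp [← cancel_mono (ι k), hl] },
    { app := ι, naturality i j f := by simp [hl] }, fun j ↦ ⟨inferInstance, hι j⟩⟩

end

namespace IsContinuousChain

variable {J : Type*} [LinearOrder J] [SuccOrder J] {F : J ⥤ C}
  {ι : F ⟶ (Functor.const J).obj L} [∀ j, Mono (ι.app j)]
  {r : (∀ a, AddSubgroup (G a ⟶ L)) → (∀ a, AddSubgroup (G a ⟶ L)) → Prop}

lemma isWellOrderContinuous [IsLocallyFinitelyPresentable.{w} C] (hG : IsFPFamily G)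
    (hF : IsContinuousChain r fun j ↦ homImage G (ι.app j)) : F.IsWellOrderContinuous where
  nonempty_isColimit l hl := by
    have := hl.nonempty_Iio.to_subtype
    have map_comp {i j : J} (f : i ⟶ j) : F.map f ≫ ι.app j = ι.app i := by simp
    have (i : Set.Iio l) : Mono (((Set.principalSegIio l).cocone F).ι.app i) :=
      mono_map_of_mono_app ι _
    refine hG.nonempty_isColimit _ fun a (x : G a ⟶ F.obj l) ↦ ?_
    have hx : x ≫ ι.app l ∈ homImage G (ι.app l) a := ⟨x, rfl⟩
    rw [hF.eq_iSup l hl, mem_iSup_apply fun (i i' : Set.Iio l) hi ↦ hF.monotone hi] at hx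
    obtain ⟨i, y, hy : y ≫ ι.app i.1 = x ≫ ι.app l⟩ := hx
    refine ⟨i, y, ?_⟩
    change y ≫ F.map (homOfLE i.2.le) = x
    rw [← cancel_mono (ι.app l), Category.assoc, map_comp, hy]

lemma exists_isPureExact_map_succ {κ : Cardinal.{w}} [Fact κ.IsRegular]
    (hF : IsContinuousChain (IsPresentableStep κ) fun j ↦ homImage G (ι.app j)) {j : J}
    (hj : ¬ IsMax j) :
    ∃ (S : C) (q : F.obj (Order.succ j) ⟶ S), IsCardinalPresentable S κ ∧
      IsPureExact G (F.map (homOfLE (Order.le_succ j))) q :=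
  hF.step j hj (F.map (homOfLE (Order.le_succ j))) (ι.app (Order.succ j)) (by simp) rfl

end IsContinuousChain

end Purity

namespace CategoryTheory.IsPure

open Purity

variable {C : Type u} [Category.{w} C] [Preadditive C] [HasFiniteBiproducts C]
  [IsLocallyFinitelyPresentable.{w} C] {A : Type w} {G : A → C}

lemma exists_transfiniteCompositionOfShape {K L : C} {h : K ⟶ L} (hh : IsPure.{w} h)
    (hG : IsFPFamily G) {κ : Cardinal.{w}} [Fact κ.IsRegular] (hℕ : HasCardinalLT ℕ κ)
    (hκ : HasCardinalLT (Arrow (InducedCategory C G)) κ) {W : MorphismProperty C}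
    (hW : ∀ ⦃K L S : C⦄ (h : K ⟶ L) (c : L ⟶ S) [Mono h] [IsCardinalPresentable S κ],
      IsPureExact G h c → W h) :
    ∃ (J : Type w) (_ : LinearOrder J) (_ : OrderBot J) (_ : SuccOrder J) (_ : WellFoundedLT J),
      Nonempty (W.TransfiniteCompositionOfShape J h) := by
  obtain ⟨J, _, _, _, _, T, hT, hTp, hbot, htop⟩ := exists_isContinuousChain
    (fun _ _ _ _ ↦ isPureSubfunctor_iSup) (fun T hT hT' ↦ hT.exists_lt hG hℕ hκ hT')
    (IsPureSubfunctor.of_isPure hG hh)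
  obtain ⟨F, ι, hι⟩ := exists_diagram hG hT.monotone hTp
  have (j : J) : Mono (ι.app j) := (hι j).1
  obtain rfl : (fun j ↦ homImage G (ι.app j)) = T := funext fun j ↦ (hι j).2
  have := hh.mono
  obtain ⟨e, he⟩ := exists_iso_of_homImage_eq hG hbot.symm
  have := isIso_of_homImage_eq_top hG htop
  have := hT.isWellOrderContinuous hG
  exact ⟨J, inferInstance, inferInstance, inferInstance, inferInstance, ⟨{
    F := F
    isoBot := e.symm
    incl := ι
    isColimit := IsColimit.ofIsoColimit (colimitOfDiagramTerminal isTerminalTop _)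
      (Cocone.ext (asIso (ι.app ⊤)) fun j ↦ (ι.naturality _).trans (Category.comp_id _))
    fac := he
    map_mem j hj := by
      have := mono_map_of_mono_app ι (homOfLE (Order.le_succ j))
      obtain ⟨S, q, _, hq⟩ := hT.exists_isPureExact_map_succ hj
      exact hW _ q hq }⟩⟩

end CategoryTheory.IsPure

namespace Purity

theorem isCofibrantlyGenerated_pureMonomorphisms (C : Type u) [Category.{w} C] [Preadditive C]
    [HasFiniteBiproducts C] [IsLocallyFinitelyPresentable.{w} C] :
    MorphismProperty.IsCofibrantlyGenerated.{w} (MorphismProperty.pureMonomorphisms.{w} C) := by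
  obtain ⟨A, G, hG⟩ := exists_isFPFamily (C := C)
  obtain ⟨κ, hκ, hκ'⟩ :=
    HasCardinalLT.exists_regular_cardinal.{w} (ℕ ⊕ Arrow (InducedCategory C G))
  have : Fact κ.IsRegular := ⟨hκ⟩
  obtain ⟨hℕ, hG'⟩ := (hasCardinalLT_sum_iff _ _ _ hκ.aleph0_le).1 hκ'
  obtain ⟨X, hX, hXle, hXκ⟩ := exists_isSmall_le_pureMonomorphisms hG κ
  refine ⟨X, hX, le_antisymm
    (fun _ _ _ hf ↦ hf _ (isCofibrantlyClosed_pureMonomorphisms C) hXle) fun K L h hh W hW hXW ↦ ?_⟩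
  have := hW.pushout
  have := hW.transfiniteComposition
  have hle : X.pushouts ≤ W := MorphismProperty.pushouts_le_iff.2 hXW
  obtain ⟨J, _, _, _, _, ⟨t⟩⟩ := hh.1.exists_transfiniteCompositionOfShape hG hℕ hG' hXκ
  exact W.transfiniteCompositionsOfShape_le J h ⟨t.ofLE hle⟩

section

variable (R : Type w) [Ring R]

lemma isFinitelyPresentable_moduleCat_self : IsFinitelyPresentable.{w} (ModuleCat.of R R) := by
  rw [isFinitelyPresentable_iff_preservesFilteredColimits]
  let e : coyoneda.obj (.op (ModuleCat.of R R)) ≅ forget (ModuleCat.{w} R) :=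
    NatIso.ofComponents (fun M ↦ ((ModuleCat.homEquiv (M := ModuleCat.of R R) (N := M)).trans
      (LinearMap.ringLmapEquivSelf R ℤ M).toEquiv).toIso) (fun f ↦ by ext; rfl)
  exact ⟨fun J _ _ ↦ preservesColimitsOfShape_of_natIso e.symm⟩

lemma isStrongGenerator_moduleCat_self :
    (ObjectProperty.singleton (ModuleCat.of R R)).IsStrongGenerator := by
  rw [ObjectProperty.isStrongGenerator_iff]
  refine ⟨fun X Y f g h ↦ ?_, fun X Y i _ h ↦ ?_⟩
  · ext x
    simpa using
      congr(($(h _ ⟨⟨⟩⟩ (ModuleCat.ofHom (LinearMap.toSpanSingleton R X x)))).hom 1)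
  · rw [ConcreteCategory.isIso_iff_bijective]
    refine ⟨(ModuleCat.mono_iff_injective i).1 inferInstance, fun y ↦ ?_⟩
    obtain ⟨p, hp⟩ := h _ ⟨⟨⟩⟩ (ModuleCat.ofHom (LinearMap.toSpanSingleton R Y y))
    exact ⟨p.hom 1, by simpa using congr(($hp).hom 1)⟩

instance isLocallyFinitelyPresentable_moduleCat :
    IsLocallyFinitelyPresentable.{w} (ModuleCat.{w} R) := by
  have : Fact Cardinal.aleph0.{w}.IsRegular := Cardinal.fact_isRegular_aleph0
  refine (IsCardinalLocallyPresentable.iff_exists_isStrongGenerator _ Cardinal.aleph0.{w}).2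
    ⟨_, inferInstance, isStrongGenerator_moduleCat_self R, ?_⟩
  rintro _ ⟨⟩
  exact isFinitelyPresentable_moduleCat_self R

end

end Purity

theorem mainTheorem1 :
    (∀ (C : Type u) [Category.{w} C] [Preadditive C] [HasFiniteBiproducts C]
      [IsLocallyFinitelyPresentable.{w} C],
      MorphismProperty.IsCofibrantlyGenerated.{w}
        (MorphismProperty.pureMonomorphisms.{w} C)) ∧
    (∀ (R : Type w) [Ring R],
      MorphismProperty.IsCofibrantlyGenerated.{w}
        (MorphismProperty.pureMonomorphisms.{w} (ModuleCat.{w} R))) :=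
  ⟨fun C ↦ Purity.isCofibrantlyGenerated_pureMonomorphisms C,
    fun R ↦ Purity.isCofibrantlyGenerated_pureMonomorphisms (ModuleCat.{w} R)⟩
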